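/- Let $Z$ and $X$ be separable reflexive real Banach spaces and let $\iota\colon Z\to X$ be an injective compact linear operator (so $Z\subset X$ is a compact embedding). Let $Z_{w*}$ be $Z$ with its weak-$*$ topology as the dual of $Z^*$; by reflexivity this is the weak topology of $Z$. Let $\psi\colon Z\to(0,\infty)$ be an admissible weight function on $Z_{w*}$, that is, the sets $K_R=\{z\in Z:\psi(z)\le R\}$ are compact in $Z_{w*}$ for all $R>0$. Let $\mathrm{B}^\psi(Z_{w*})$ be the space of functions $f\colon Z\to\mathbb{R}$ with $\|f\|_\psi:=\sup_{z\in Z}\psi(z)^{-1}|f(z)|<\infty$, normed by $\|\cdot\|_\psi$, and let $\mathcal{B}^\psi(Z_{w*})$ be the closure in it of the space $\mathrm{C}_b(Z_{w*})$ of bounded weak-$*$ continuous functions. On a filtered probability space $(\Omega,\mathcal{F},\mathbb{P},(\mathcal{F}_t)_{t\ge0})$ let $(x(t,z))_{t\ge0}$, $z\in Z$, be a time homogeneous Markov process with values in $Z$: each $x(t,z)$ is $\mathcal{F}_t$-measurable (for the Borel $\sigma$-algebra of $Z$), $x(0,z)=z$ almost surely, $z\mapsto\mathbb{P}[x(t,z)\in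 A]$ is measurable for every Borel set $A$ and every $t\ge0$, and $\mathbb{P}[x(s+t,z)\in A\mid\mathcal{F}_s]=p_t(x(s,z),A)$ almost surely for all $s,t\ge 0$, where $p_t(z',A):=\mathbb{P}[x(t,z')\in A]$. Assume that for every $z\in Z$ the trajectories of $x(\cdot,z)$ are almost surely right continuous in $Z_{w*}$, and that there are constants $C\in\mathbb{R}$ and $\varepsilon>0$ with $$\mathbb{E}[\psi(x(t,z))]\le C\psi(z)\quad\text{for all }z\in Z,\ t\in[0,\varepsilon].$$ Suppose that the process extends to $X$: there is a time homogeneous Markov process $(y(t,x_0))_{t\ge0}$, $x_0\in X$, with values in $X$ (in the same sense, on the same filtered probability space) such that $y(t,\iota z)=\iota x(t,z)$ almost surely for all $t\ge0$, $z\in Z$. Suppose finally that for every $t\ge0$ and every bounded norm-continuous $f\colon X\to\mathbb{R}$ the map $x_0\mapsto\mathbb{E}[f(y(t,x_0))]$ is norm-continuous on $X$. Then for all $t\ge0$, $f\in\mathcal{B}^\psi(Z_{w*})$ and $z\in Z$ the random variable $f(x(t,z))$ is integrable, and $P_tf(z):=\mathbb{E}[f(x(t,z))]$ defines bounded linear operators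 $P_t\colon\mathcal{B}^\psi(Z_{w*})\to\mathcal{B}^\psi(Z_{w*})$ that form a generalised Feller semigroup, that is, 1. $P_0=I$; 2. $P_{t+s}=P_tP_s$ for all $s,t\ge0$; 3. $\lim_{t\to0+}P_tf(z)=f(z)$ for all $f\in\mathcal{B}^\psi(Z_{w*})$ and $z\in Z$; 4. there are $C'\in\mathbb{R}$ and $\varepsilon'>0$ with $\|P_t\|\le C'$ for all $t\in[0,\varepsilon']$; 5. $P_tf\ge0$ for all $t\ge0$ and all $f\in\mathcal{B}^\psi(Z_{w*})$ with $f\ge0$. Moreover $(P_t)_{t\ge0}$ is strongly continuous: $\lim_{t\to0+}\|P_tf-f\|_\psi=0$ for all $f\in\mathcal{B}^\psi(Z_{w*})$. -/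

import Mathlib

open MeasureTheory Filter Topology
open scoped NNReal ENNReal

/-- An admissible weight function on a topological space: a function `ψ : S → (0, ∞)` all of whose
sublevel sets `K_R = {s | ψ s ≤ R}`, `R > 0`, are compact. -/
structure AdmissibleWeight (S : Type*) [TopologicalSpace S] where
  toFun : S → ℝ
  pos' : ∀ s, 0 < toFun s
  isCompact_sublevel' : ∀ R : ℝ, 0 < R → IsCompact {s | toFun s ≤ R}

instance {S : Type*} [TopologicalSpace S] : CoeFun (AdmissibleWeight S) (fun _ => S → ℝ) :=
  ⟨AdmissibleWeight.toFun⟩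

section WeightedSpaces

variable {S : Type*} [TopologicalSpace S]

/-- The real functions `f` on `S` with `sup_s ψ(s)⁻¹ |f(s)| < ∞`, as a linear subspace of all
functions. -/
def weightedBoundedSubmodule (ψ : AdmissibleWeight S) : Submodule ℝ (S → ℝ) where
  carrier := {f | BddAbove (Set.range fun s => (ψ s)⁻¹ * ‖f s‖)}
  add_mem' := by
    rintro f g ⟨a, ha⟩ ⟨b, hb⟩
    refine ⟨a + b, ?_⟩
    rintro _ ⟨s, rfl⟩
    have h1 : (ψ s)⁻¹ * ‖f s‖ ≤ a := ha ⟨s, rfl⟩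
    have h2 : (ψ s)⁻¹ * ‖g s‖ ≤ b := hb ⟨s, rfl⟩
    have h3 : (ψ s)⁻¹ * ‖f s + g s‖ ≤ (ψ s)⁻¹ * (‖f s‖ + ‖g s‖) :=
      mul_le_mul_of_nonneg_left (norm_add_le _ _) (inv_nonneg.2 (ψ.pos' s).le)
    simp only [Pi.add_apply]
    linarith
  zero_mem' := by
    refine ⟨0, ?_⟩
    rintro _ ⟨s, rfl⟩
    simp
  smul_mem' := by
    rintro c f ⟨a, ha⟩
    refine ⟨‖c‖ * a, ?_⟩
    rintro _ ⟨s, rfl⟩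
    have h1 : (ψ s)⁻¹ * ‖f s‖ ≤ a := ha ⟨s, rfl⟩
    have h2 := mul_le_mul_of_nonneg_left h1 (norm_nonneg c)
    simp only [Pi.smul_apply, smul_eq_mul, norm_mul]
    linarith

/-- The space `B^ψ(S)` of real functions on `S` that are bounded relative to `ψ`. (A type of its
own, so that it does not carry the topology of pointwise convergence.) -/
def WeightedBounded (ψ : AdmissibleWeight S) : Type _ := weightedBoundedSubmodule ψ

namespace WeightedBounded

variable (ψ : AdmissibleWeight S)

noncomputable instance : AddCommGroup (WeightedBounded ψ) :=
  inferInstanceAs (AddCommGroup (weightedBoundedSubmodule ψ))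

noncomputable instance : Module ℝ (WeightedBounded ψ) :=
  inferInstanceAs (Module ℝ (weightedBoundedSubmodule ψ))

instance : CoeFun (WeightedBounded ψ) (fun _ => S → ℝ) := ⟨Subtype.val⟩

/-- The weighted supremum norm `‖f‖_ψ = sup_s ψ(s)⁻¹ |f(s)|`. -/
noncomputable instance : Norm (WeightedBounded ψ) := ⟨fun f => ⨆ s, (ψ s)⁻¹ * ‖f s‖⟩

variable {ψ}

theorem norm_def (f : WeightedBounded ψ) : ‖f‖ = ⨆ s, (ψ s)⁻¹ * ‖f s‖ := rfl

theorem le_norm (f : WeightedBounded ψ) (s : S) : (ψ s)⁻¹ * ‖f s‖ ≤ ‖f‖ :=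
  le_ciSup (f := fun s => (ψ s)⁻¹ * ‖f s‖) f.2 s

theorem normedSpaceCore (ψ : AdmissibleWeight S) :
    NormedSpace.Core ℝ (WeightedBounded ψ) where
  norm_nonneg f :=
    Real.iSup_nonneg fun s => mul_nonneg (inv_nonneg.2 (ψ.pos' s).le) (norm_nonneg _)
  norm_smul c f := by
    rw [norm_def, norm_def, Real.mul_iSup_of_nonneg (norm_nonneg c)]
    refine iSup_congr fun s => ?_
    change (ψ s)⁻¹ * ‖c * f s‖ = _
    rw [norm_mul]
    ring
  norm_triangle f g := by
    rw [norm_def (f + g)]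
    refine Real.iSup_le (fun s => ?_) (add_nonneg
      (Real.iSup_nonneg fun s => mul_nonneg (inv_nonneg.2 (ψ.pos' s).le) (norm_nonneg _))
      (Real.iSup_nonneg fun s => mul_nonneg (inv_nonneg.2 (ψ.pos' s).le) (norm_nonneg _)))
    have h1 := le_norm f s
    have h2 := le_norm g s
    have h3 : (ψ s)⁻¹ * ‖f s + g s‖ ≤ (ψ s)⁻¹ * (‖f s‖ + ‖g s‖) :=
      mul_le_mul_of_nonneg_left (norm_add_le _ _) (inv_nonneg.2 (ψ.pos' s).le)
    change (ψ s)⁻¹ * ‖f s + g s‖ ≤ _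
    linarith
  norm_eq_zero_iff f := by
    constructor
    · intro h
      refine Subtype.ext (funext fun s => ?_)
      have h1 := le_norm f s
      rw [h] at h1
      have h2 : ‖f s‖ ≤ 0 := by
        by_contra h3
        have := mul_pos (inv_pos.2 (ψ.pos' s)) (not_le.1 h3)
        linarith
      exact norm_le_zero_iff.1 h2
    · rintro rfl
      rw [norm_def]
      change (⨆ s, (ψ s)⁻¹ * ‖(0 : ℝ)‖) = 0
      simp

noncomputable instance : NormedAddCommGroup (WeightedBounded ψ) :=
  NormedAddCommGroup.ofCore (normedSpaceCore ψ)

noncomputable instance : NormedSpace ℝ (WeightedBounded ψ) :=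
  NormedSpace.ofCore (normedSpaceCore ψ)

end WeightedBounded

/-- On a Hausdorff space an admissible weight is bounded away from `0`. -/
theorem AdmissibleWeight.exists_pos_le [T2Space S] (ψ : AdmissibleWeight S) :
    ∃ δ : ℝ, 0 < δ ∧ ∀ s, δ ≤ ψ s := by
  have hpos : ∀ n : ℕ, (0 : ℝ) < ((n : ℝ) + 1)⁻¹ := fun n => by positivity
  obtain ⟨n, hn⟩ := (ψ.isCompact_sublevel' 1 one_pos).elim_directed_cover
    (fun n : ℕ => {s | ψ s ≤ ((n : ℝ) + 1)⁻¹}ᶜ)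
    (fun n => (ψ.isCompact_sublevel' _ (hpos n)).isClosed.isOpen_compl)
    (fun s _ => by
      obtain ⟨n, hn⟩ := exists_nat_one_div_lt (ψ.pos' s)
      refine Set.mem_iUnion.2 ⟨n, fun h => ?_⟩
      rw [one_div] at hn
      exact absurd (hn.trans_le h) (lt_irrefl _))
    (directed_of_isDirected_le fun a b hab s hs h => hs (by
      have hab' : (a : ℝ) ≤ b := Nat.cast_le.2 hab
      have h1 : ((b : ℝ) + 1)⁻¹ ≤ ((a : ℝ) + 1)⁻¹ :=
        inv_anti₀ (by positivity) (by linarith)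
      exact le_trans h h1))
  refine ⟨min 1 ((n : ℝ) + 1)⁻¹, lt_min one_pos (hpos n), fun s => ?_⟩
  by_cases h : ψ s ≤ 1
  · have h1 : ¬ ψ s ≤ ((n : ℝ) + 1)⁻¹ := hn h
    exact (min_le_right _ _).trans (not_le.1 h1).le
  · exact (min_le_left _ _).trans (not_le.1 h).le

/-- On a Hausdorff space every bounded function lies in `B^ψ(S)`, so the next submodule is all of
`C_b(S)`. -/
theorem mem_weightedBoundedSubmodule_of_bounded [T2Space S] (ψ : AdmissibleWeight S) (f : S → ℝ)
    (M : ℝ) (hM : ∀ s, ‖f s‖ ≤ M) : f ∈ weightedBoundedSubmodule ψ := by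
  obtain ⟨δ, hδ, h⟩ := ψ.exists_pos_le
  refine ⟨δ⁻¹ * M, ?_⟩
  rintro _ ⟨s, rfl⟩
  exact mul_le_mul (inv_anti₀ hδ (h s)) (hM s) (norm_nonneg _) (inv_nonneg.2 hδ.le)

/-- The bounded continuous functions `C_b(S)`, as a subspace of `B^ψ(S)`. -/
def boundedContinuousSubmodule (ψ : AdmissibleWeight S) : Submodule ℝ (WeightedBounded ψ) where
  carrier := {f | Continuous (f : S → ℝ) ∧ ∃ M : ℝ, ∀ s, ‖f s‖ ≤ M}
  add_mem' := by
    rintro f g ⟨hf, a, ha⟩ ⟨hg, b, hb⟩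
    exact ⟨hf.add hg, a + b, fun s => (norm_add_le _ _).trans (add_le_add (ha s) (hb s))⟩
  zero_mem' := ⟨continuous_const (y := (0 : ℝ)), 0, fun _ => (norm_zero (E := ℝ)).le⟩
  smul_mem' := by
    rintro c f ⟨hf, a, ha⟩
    refine ⟨hf.const_smul c, ‖c‖ * a, fun s => ?_⟩
    change ‖c * f s‖ ≤ _
    rw [norm_mul]
    exact mul_le_mul_of_nonneg_left (ha s) (norm_nonneg c)

/-- The space `𝓑^ψ(S)` of functions with growth controlled by `ψ`: the closure of `C_b(S)` in
`B^ψ(S)`, with the norm of `B^ψ(S)`. -/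
abbrev GrowthControlled (ψ : AdmissibleWeight S) : Type _ :=
  (boundedContinuousSubmodule ψ).topologicalClosure

/-- A generalised Feller semigroup on `𝓑^ψ(S)`. -/
structure IsGeneralisedFellerSemigroup {ψ : AdmissibleWeight S}
    (P : ℝ≥0 → GrowthControlled ψ →L[ℝ] GrowthControlled ψ) : Prop where
  map_zero : P 0 = ContinuousLinearMap.id ℝ (GrowthControlled ψ)
  map_add : ∀ t s : ℝ≥0, P (t + s) = (P t).comp (P s)
  tendsto_pointwise : ∀ (f : GrowthControlled ψ) (s : S),
    Tendsto (fun t : ℝ≥0 => (P t f).1 s) (𝓝[>] 0) (𝓝 (f.1 s))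
  norm_bounded : ∃ C : ℝ, ∃ ε : ℝ≥0, 0 < ε ∧ ∀ t ≤ ε, ‖P t‖ ≤ C
  nonneg : ∀ (t : ℝ≥0) (f : GrowthControlled ψ), (∀ s, 0 ≤ f.1 s) → ∀ s, 0 ≤ (P t f).1 s

/-- Strong continuity at `0+` of a family of operators on `𝓑^ψ(S)`. -/
def IsStronglyContinuousAtZero {ψ : AdmissibleWeight S}
    (P : ℝ≥0 → GrowthControlled ψ →L[ℝ] GrowthControlled ψ) : Prop :=
  ∀ f : GrowthControlled ψ, Tendsto (fun t : ℝ≥0 => ‖P t f - f‖) (𝓝[>] 0) (𝓝 0)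

end WeightedSpaces

/-- A normed space is reflexive if the canonical map into its bidual is onto. -/
def IsReflexiveSpace (E : Type*) [NormedAddCommGroup E] [NormedSpace ℝ E] : Prop :=
  Function.Surjective (NormedSpace.inclusionInDoubleDual ℝ E)

/-- A time homogeneous Markov process with state space `E` on the stochastic basis `(Ω, μ, ℱ)`:
`x t e` is the position at time `t` of the process started at `e`. The transition probabilities
`p_t(e, A) = μ(x t e ∈ A)` are measurable in `e`, and
`μ(x (s + t) e ∈ A | ℱ_s) = p_t(x s e, A)` almost surely. -/
structure IsMarkovProcess {Ω E : Type*} [MeasurableSpace E] {mΩ : MeasurableSpace Ω}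
    (μ : Measure Ω) (ℱ : Filtration ℝ≥0 mΩ) (x : ℝ≥0 → E → Ω → E) : Prop where
  adapted : ∀ (t : ℝ≥0) (e : E), Measurable[ℱ t] (x t e)
  start : ∀ e : E, ∀ᵐ ω ∂μ, x 0 e ω = e
  measurable_transition : ∀ (t : ℝ≥0) (A : Set E), MeasurableSet A →
    Measurable fun e => μ {ω | x t e ω ∈ A}
  markov : ∀ (s t : ℝ≥0) (e : E) (A : Set E), MeasurableSet A →
    μ[{ω | x (s + t) e ω ∈ A}.indicator (fun _ => (1 : ℝ)) | ℱ s] =ᵐ[μ]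
      fun ω => μ.real {ω' | x t (x s e ω) ω' ∈ A}

/-! The difficulty is that `P_t` must map `𝓑^ψ` into itself. A sublevel set `K_R` is weakly compact,
hence norm bounded, so the compact injective `ι` restricts to a homeomorphism of `K_R` onto a norm
compact subset of `X`. By Tietze a bounded weakly continuous function on `K_R` is therefore `q ∘ ι`
for some bounded continuous `q` on `X`, and functions `q ∘ ι` are dense in `𝓑^ψ`
(`exists_boundedContinuous_approx`). On them `P_t (q ∘ ι) = (Q_t q) ∘ ι`, with `Q_t` the transition
operators on `X`; `Q_t q` is norm continuous, so the result is bounded and continuous on every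
`K_R`, which suffices for membership in `𝓑^ψ` (`mem_closure_of_continuousOn`). The moment bound,
iterated along Chapman-Kolmogorov, makes `P_t` bounded, and density finishes
(`WeightBound.exists_operator`).

For strong continuity let `f` be weakly continuous with `|f| ≤ M`. Right continuous paths make `t ↦
P_t f(z)` right continuous, so the averages `h⁻¹ ∫₀ʰ P_r f dr` exist, lie in `𝓑^ψ`, satisfy `‖P_t g
- g‖ → 0` and tend to `f` pointwise, bounded by `M` (`exists_time_average`). By Riesz representation
and Hahn-Banach on `C(K_R)`, bounded pointwise limits lie in the norm closure of convex sets; off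
`K_R` the weight absorbs the bound `M`. Hence vectors with norm continuous orbit at `0` are dense,
and local boundedness of `‖P_t‖` extends this to all of `𝓑^ψ`. Pointwise convergence is a
consequence. -/

/-! ### Bounded pointwise limits and convex sets in `C(K)` -/

section ContinuousFunctionsOnCompact

variable {K : Type*} [TopologicalSpace K] [CompactSpace K]

/-- The norm of the positive part is a sublinear functional on `C(K)`. -/
theorem ContinuousMap.norm_sup_zero_add_le (F G : C(K, ℝ)) :
    ‖(F + G) ⊔ 0‖ ≤ ‖F ⊔ 0‖ + ‖G ⊔ 0‖ := by
  refine (ContinuousMap.norm_le _ (by positivity)).2 fun k => ?_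
  have h1 := (F ⊔ 0).norm_coe_le_norm k
  have h2 := (G ⊔ 0).norm_coe_le_norm k
  simp only [ContinuousMap.sup_apply, ContinuousMap.add_apply, ContinuousMap.zero_apply,
    Real.norm_eq_abs, abs_of_nonneg (le_sup_right : (0 : ℝ) ≤ _ ⊔ 0)] at h1 h2 ⊢
  refine sup_le ?_ (by positivity)
  linarith [le_sup_left.trans h1, le_sup_left.trans h2]

theorem ContinuousMap.norm_smul_sup_zero (c : ℝ) (hc : 0 < c) (F : C(K, ℝ)) :
    ‖(c • F) ⊔ 0‖ = c * ‖F ⊔ 0‖ := by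
  have : (c • F) ⊔ 0 = c • (F ⊔ 0) := by
    ext k
    simp [mul_max_of_nonneg _ _ hc.le]
  rw [this, norm_smul, Real.norm_of_nonneg hc.le]

theorem ContinuousMap.norm_le_norm_sup_zero_add (F : C(K, ℝ)) :
    ‖F‖ ≤ ‖F ⊔ 0‖ + ‖(-F) ⊔ 0‖ := by
  refine (ContinuousMap.norm_le _ (by positivity)).2 fun k => ?_
  have h1 := (F ⊔ 0).norm_coe_le_norm k
  have h2 := ((-F) ⊔ 0).norm_coe_le_norm k
  simp only [ContinuousMap.sup_apply, ContinuousMap.neg_apply, ContinuousMap.zero_apply,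
    Real.norm_eq_abs, abs_of_nonneg (le_sup_right : (0 : ℝ) ≤ _ ⊔ 0)] at h1 h2 ⊢
  refine abs_le'.2 ⟨?_, ?_⟩
  · linarith [le_sup_left.trans h1, norm_nonneg ((-F) ⊔ 0)]
  · linarith [le_sup_left.trans h2, norm_nonneg (F ⊔ 0)]

/-- A bounded linear functional on `C(K)` is a difference of positive ones. -/
theorem exists_positive_sub_positive (ℓ : C(K, ℝ) →L[ℝ] ℝ) :
    ∃ Λ₁ Λ₂ : C(K, ℝ) →ₗ[ℝ] ℝ, (∀ F, 0 ≤ F → 0 ≤ Λ₁ F) ∧ (∀ F, 0 ≤ F → 0 ≤ Λ₂ F) ∧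
      ∀ F, ℓ F = Λ₁ F - Λ₂ F := by
  -- Transport `ℓ` to the pairs `(F, -F)`, where the sublinear `N` dominates it. Since `N` vanishes
  -- on pairs of nonpositive functions, an extension dominated by `N` is positive, and its
  -- restrictions to the two factors are `Λ₁` and `Λ₂`.
  let j : C(K, ℝ) →ₗ[ℝ] C(K, ℝ) × C(K, ℝ) := LinearMap.prod LinearMap.id (-LinearMap.id)
  have hj : Function.Injective j := fun F G h => congrArg Prod.fst h
  let e := LinearEquiv.ofInjective j hj
  let f : (C(K, ℝ) × C(K, ℝ)) →ₗ.[ℝ] ℝ := ⟨LinearMap.range j, ℓ.toLinearMap ∘ₗ e.symm.toLinearMap⟩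
  let N : C(K, ℝ) × C(K, ℝ) → ℝ := fun F => ‖ℓ‖ * (‖F.1 ⊔ 0‖ + ‖F.2 ⊔ 0‖)
  obtain ⟨g, hg, hN⟩ := exists_extension_of_le_sublinear f N
    (fun c hc F => by
      simp only [N, Prod.smul_fst, Prod.smul_snd, ContinuousMap.norm_smul_sup_zero c hc]
      ring)
    (fun F G => by
      simp only [N, Prod.fst_add, Prod.snd_add, ← mul_add]
      refine mul_le_mul_of_nonneg_left ?_ ℓ.opNorm_nonneg
      linarith [ContinuousMap.norm_sup_zero_add_le F.1 G.1,
        ContinuousMap.norm_sup_zero_add_le F.2 G.2])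
    (by
      intro u
      obtain ⟨F, rfl⟩ := e.surjective u
      change ℓ (e.symm (e F)) ≤ ‖ℓ‖ * (‖F ⊔ 0‖ + ‖(-F) ⊔ 0‖)
      rw [e.symm_apply_apply]
      exact ((le_abs_self _).trans (ℓ.le_opNorm F)).trans
        (mul_le_mul_of_nonneg_left (ContinuousMap.norm_le_norm_sup_zero_add F) ℓ.opNorm_nonneg))
  have hpos : ∀ F G : C(K, ℝ), 0 ≤ F → 0 ≤ G → 0 ≤ g (F, G) := by
    intro F G hF hG
    have h := hN (-(F, G))
    have h1 : (-F) ⊔ 0 = 0 := sup_eq_right.2 (neg_nonpos.2 hF)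
    have h2 : (-G) ⊔ 0 = 0 := sup_eq_right.2 (neg_nonpos.2 hG)
    simp only [N, Prod.fst_neg, Prod.snd_neg, map_neg, h1, h2, norm_zero] at h
    linarith
  refine ⟨g ∘ₗ LinearMap.inl ℝ _ _, g ∘ₗ LinearMap.inr ℝ _ _,
    fun F hF => hpos F 0 hF le_rfl, fun F hF => hpos 0 F le_rfl hF, fun F => ?_⟩
  have h : ℓ F = g (F, -F) := by
    rw [show ((F, -F) : C(K, ℝ) × C(K, ℝ)) = (e F : C(K, ℝ) × C(K, ℝ)) from rfl]
    refine Eq.trans ?_ (hg (e F)).symm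
    change ℓ F = ℓ (e.symm (e F))
    rw [e.symm_apply_apply]
  rw [h]
  change _ = g (F, 0) - g (0, F)
  rw [← map_sub]
  simp

variable [T2Space K]

/-- A positive linear functional on `C(K)` is continuous along bounded pointwise convergent
sequences. -/
theorem tendsto_of_positive_of_tendsto_pointwise (Λ : C(K, ℝ) →ₗ[ℝ] ℝ)
    (hΛ : ∀ F, 0 ≤ F → 0 ≤ Λ F) {u : ℕ → C(K, ℝ)} {v : C(K, ℝ)} {M : ℝ}
    (hM : ∀ n k, ‖u n k‖ ≤ M) (huv : ∀ k, Tendsto (fun n => u n k) atTop (𝓝 (v k))) :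
    Tendsto (fun n => Λ (u n)) atTop (𝓝 (Λ v)) := by
  borelize K
  -- Riesz-Markov-Kakutani turns `Λ` into integration against a finite measure, so dominated
  -- convergence applies.
  let Λ' : CompactlySupportedContinuousMap K ℝ →ₚ[ℝ] ℝ := PositiveLinearMap.mk₀
    { toFun := fun F => Λ F.toContinuousMap
      map_add' := fun F G => by rw [← map_add]; rfl
      map_smul' := fun c F => by rw [RingHom.id_apply, ← map_smul]; rfl }
    (fun F hF => hΛ _ hF)
  have hint : ∀ F : C(K, ℝ), Λ F = ∫ k, F k ∂(RealRMK.rieszMeasure Λ') := fun F =>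
    (RealRMK.integral_rieszMeasure Λ' (CompactlySupportedContinuousMap.continuousMapEquiv F)).symm
  simp only [hint]
  exact tendsto_integral_of_dominated_convergence (fun _ => M)
    (fun n => (u n).continuous.aestronglyMeasurable) (integrable_const M)
    (fun n => Eventually.of_forall (hM n)) (Eventually.of_forall huv)

/-- In `C(K)` the limit of a bounded pointwise convergent sequence lies in the norm closure of every
convex set that contains the sequence. -/
theorem Convex.mem_closure_of_tendsto_pointwise {s : Set C(K, ℝ)} (hs : Convex ℝ s)
    {u : ℕ → C(K, ℝ)} {v : C(K, ℝ)} {M : ℝ} (hus : ∀ n, u n ∈ s)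
    (hM : ∀ n k, ‖u n k‖ ≤ M) (huv : ∀ k, Tendsto (fun n => u n k) atTop (𝓝 (v k))) :
    v ∈ closure s := by
  by_contra hv
  obtain ⟨ℓ, c, h1, h2⟩ := geometric_hahn_banach_point_closed hs.closure isClosed_closure hv
  obtain ⟨Λ₁, Λ₂, hΛ₁, hΛ₂, hℓ⟩ := exists_positive_sub_positive ℓ
  have h : Tendsto (fun n => ℓ (u n)) atTop (𝓝 (ℓ v)) := by
    simp only [hℓ]
    exact (tendsto_of_positive_of_tendsto_pointwise Λ₁ hΛ₁ hM huv).sub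
      (tendsto_of_positive_of_tendsto_pointwise Λ₂ hΛ₂ hM huv)
  exact (ge_of_tendsto' h fun n => (h2 _ (subset_closure (hus n))).le).not_gt h1

end ContinuousFunctionsOnCompact

/-! ### Weakly compact sets and compact operators -/

section WeakTopology

variable {Z : Type*} [NormedAddCommGroup Z] [NormedSpace ℝ Z]

instance : T2Space (WeakSpace ℝ Z) :=
  (NormedSpace.isEmbedding_inclusionInDoubleDualWeak ℝ Z).t2Space

/-- Weakly compact sets are norm bounded. -/
theorem IsCompact.isBounded_preimage_toWeakSpace {K : Set (WeakSpace ℝ Z)} (hK : IsCompact K) :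
    Bornology.IsBounded (toWeakSpace ℝ Z ⁻¹' K) := by
  have h := hK.image (NormedSpace.inclusionInDoubleDualWeak ℝ Z).continuous
  -- Uniform boundedness on the Banach space `Z*`: weak-star bounded sets of the bidual are norm
  -- bounded.
  have h1 := WeakDual.isBounded_iff_isVonNBounded.2 (h.isVonNBounded ℝ)
  refine ((NormedSpace.inclusionInDoubleDualLi ℝ (E := Z)).antilipschitz.isBounded_preimage
    (s := NormedSpace.inclusionInDoubleDualWeak ℝ Z '' K) h1).subset fun z hz => ?_
  exact ⟨toWeakSpace ℝ Z z, hz, rfl⟩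

variable {X : Type*} [NormedAddCommGroup X] [NormedSpace ℝ X]

/-- A compact operator is weak-to-norm continuous on weakly compact sets. -/
theorem IsCompactOperator.continuousOn_of_isCompact {ι : Z →L[ℝ] X} (hι : IsCompactOperator ι)
    {K : Set (WeakSpace ℝ Z)} (hK : IsCompact K) :
    ContinuousOn (fun w : WeakSpace ℝ Z => ι ((toWeakSpace ℝ Z).symm w)) K := by
  obtain ⟨T, hT, hsub⟩ := hι.image_subset_compact_of_bounded (f := ι.toLinearMap)
    hK.isBounded_preimage_toWeakSpace
  have : CompactSpace T := isCompact_iff_compactSpace.1 hT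
  -- On the norm compact `T` the norm topology equals the coarser Hausdorff weak topology, so the
  -- weak-to-weak continuity of `ι` is enough.
  let j : T → WeakSpace ℝ X := fun a => toWeakSpace ℝ X a
  have hj : IsClosedEmbedding j := Continuous.isClosedEmbedding
    ((toWeakSpaceCLM ℝ X).continuous.comp continuous_subtype_val)
    ((toWeakSpace ℝ X).injective.comp Subtype.val_injective)
  let g : K → T := fun w => ⟨ι ((toWeakSpace ℝ Z).symm w), hsub ⟨_, w.2, rfl⟩⟩
  have hg : Continuous g := by
    refine hj.isEmbedding.continuous_iff.2 ?_
    exact (WeakSpace.map ι).continuous.comp continuous_subtype_val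
  exact continuousOn_iff_continuous_domRestrict.2 (continuous_subtype_val.comp hg)

/-- An injective compact operator embeds weakly compact sets into the target with its norm
topology. -/
theorem IsCompactOperator.isClosedEmbedding_of_isCompact {ι : Z →L[ℝ] X} (hι : IsCompactOperator ι)
    (hι_inj : Function.Injective ι) {K : Set (WeakSpace ℝ Z)} (hK : IsCompact K) :
    IsClosedEmbedding fun w : K => ι ((toWeakSpace ℝ Z).symm w.1) := by
  have : CompactSpace K := isCompact_iff_compactSpace.1 hK
  exact Continuous.isClosedEmbedding
    (continuousOn_iff_continuous_domRestrict.1 (hι.continuousOn_of_isCompact hK))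
    (hι_inj.comp ((toWeakSpace ℝ Z).symm.injective.comp Subtype.val_injective))

end WeakTopology

/-! ### Approximation and continuity in `𝓑^ψ` -/

section Weighted

variable {S : Type*} [TopologicalSpace S] {ψ : AdmissibleWeight S}

/-- Makes a regular space normal, through the Lindelöf property, as Tietze's theorem requires. -/
theorem AdmissibleWeight.sigmaCompactSpace (ψ : AdmissibleWeight S) : SigmaCompactSpace S := by
  refine ⟨⟨fun n : ℕ => {s | ψ s ≤ (n : ℝ) + 1},
    fun n => ψ.isCompact_sublevel' _ (by positivity), Set.eq_univ_of_forall fun s => ?_⟩⟩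
  obtain ⟨n, hn⟩ := exists_nat_ge (ψ s)
  exact Set.mem_iUnion.2 ⟨n, hn.trans (by linarith)⟩

theorem WeightedBounded.norm_le {f : WeightedBounded ψ} {c : ℝ} (hc : 0 ≤ c)
    (h : ∀ s, ‖f s‖ ≤ c * ψ s) : ‖f‖ ≤ c := by
  refine Real.iSup_le (fun s => ?_) hc
  rw [inv_mul_eq_div, div_le_iff₀ (ψ.pos' s)]
  exact h s

theorem WeightedBounded.norm_apply_le (f : WeightedBounded ψ) (s : S) : ‖f s‖ ≤ ‖f‖ * ψ s := by
  have h := WeightedBounded.le_norm f s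
  rwa [inv_mul_eq_div, div_le_iff₀ (ψ.pos' s)] at h

theorem GrowthControlled.norm_apply_le (f : GrowthControlled ψ) (s : S) :
    ‖f.1 s‖ ≤ ‖f‖ * ψ s := WeightedBounded.norm_apply_le f.1 s

theorem GrowthControlled.norm_le {f : GrowthControlled ψ} {c : ℝ} (hc : 0 ≤ c)
    (h : ∀ s, ‖f.1 s‖ ≤ c * ψ s) : ‖f‖ ≤ c := WeightedBounded.norm_le hc h

@[simp]
theorem WeightedBounded.sub_apply (f g : WeightedBounded ψ) (s : S) : (f - g) s = f s - g s := rfl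

/-- Elements of `𝓑^ψ` are approximated by bounded continuous functions. -/
theorem GrowthControlled.exists_approx (f : GrowthControlled ψ) {η : ℝ} (hη : 0 < η) :
    ∃ g : GrowthControlled ψ, Continuous (g.1 : S → ℝ) ∧ (∃ M : ℝ, ∀ s, ‖g.1 s‖ ≤ M) ∧
      ‖f - g‖ < η := by
  obtain ⟨g, hg, h⟩ := Metric.mem_closure_iff.1 f.2 η hη
  rw [dist_eq_norm] at h
  exact ⟨⟨g, subset_closure hg⟩, hg.1, hg.2, h⟩

theorem mem_closure_of_approx {f : WeightedBounded ψ}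
    (h : ∀ η : ℝ, 0 < η → ∃ g : GrowthControlled ψ, ‖f - g.1‖ ≤ η) :
    f ∈ (boundedContinuousSubmodule ψ).topologicalClosure := by
  have hc := (boundedContinuousSubmodule ψ).isClosed_topologicalClosure
  refine hc.closure_subset (Metric.mem_closure_iff.2 fun η hη => ?_)
  obtain ⟨g, hg⟩ := h (η / 2) (by linarith)
  exact ⟨g.1, g.2, by rw [dist_eq_norm]; linarith⟩

/-- Elements of `𝓑^ψ` are continuous on the sublevel sets of the weight. -/
theorem GrowthControlled.continuousOn (f : GrowthControlled ψ) (R : ℝ) (hR : 0 < R) :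
    ContinuousOn (f.1 : S → ℝ) {s | ψ s ≤ R} := by
  refine continuousOn_of_uniform_approx_of_continuousOn fun u hu => ?_
  obtain ⟨η, hη, hu⟩ := Metric.mem_uniformity_dist.1 hu
  obtain ⟨g, hg, -, hfg⟩ := f.exists_approx (div_pos hη hR)
  refine ⟨g.1, hg.continuousOn, fun s hs => hu ?_⟩
  rw [dist_eq_norm]
  calc ‖f.1 s - g.1 s‖ ≤ ‖f - g‖ * ψ s := (f - g).norm_apply_le s
    _ ≤ ‖f - g‖ * R := mul_le_mul_of_nonneg_left hs (norm_nonneg _)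
    _ < η := by rwa [lt_div_iff₀ hR] at hfg

/-- If `f` and `g` are bounded by `M` and close on `{ψ ≤ R}` then they are close in `B^ψ`. -/
theorem WeightedBounded.norm_sub_le_of_sublevel {f g : WeightedBounded ψ} {M R η δ c : ℝ}
    (hc : 0 ≤ c) (hf : ∀ s, ‖f s‖ ≤ M) (hg : ∀ s, ‖g s‖ ≤ M)
    (hδ : ∀ s, δ ≤ ψ s) (hη : η ≤ c * δ) (hR : 2 * M ≤ c * R)
    (hfg : ∀ s, ψ s ≤ R → ‖f s - g s‖ ≤ η) : ‖f - g‖ ≤ c := by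
  refine norm_le hc fun s => ?_
  rw [sub_apply]
  -- Inside, `η ≤ c * δ ≤ c * ψ s`; outside, the trivial bound `2 * M` is absorbed by `c * ψ s`.
  by_cases hs : ψ s ≤ R
  · exact (hfg s hs).trans (hη.trans (mul_le_mul_of_nonneg_left (hδ s) hc))
  · have h1 := mul_le_mul_of_nonneg_left (not_le.1 hs).le hc
    linarith [norm_sub_le (f s) (g s), hf s, hg s]

variable [T2Space S]

/-- Bounded functions which are continuous on the sublevel sets of the weight belong to `𝓑^ψ`. -/
theorem mem_closure_of_continuousOn [RegularSpace S] {f : WeightedBounded ψ} {M : ℝ}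
    (hM : ∀ s, ‖f s‖ ≤ M)
    (hf : ∀ R : ℝ, 0 < R → ContinuousOn (f : S → ℝ) {s | ψ s ≤ R}) :
    f ∈ (boundedContinuousSubmodule ψ).topologicalClosure := by
  have := ψ.sigmaCompactSpace
  refine mem_closure_of_approx fun η hη => ?_
  obtain ⟨δ, hδ, hψ⟩ := ψ.exists_pos_le
  let R := max 1 (2 * M / η)
  have hR : 0 < R := lt_max_of_lt_left one_pos
  rcases isEmpty_or_nonempty S with hS | ⟨⟨s₀⟩⟩
  · exact ⟨0, WeightedBounded.norm_le hη.le fun s => hS.elim s⟩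
  have hM0 : 0 ≤ M := (norm_nonneg _).trans (hM s₀)
  let K := {s | ψ s ≤ R}
  let F : BoundedContinuousFunction K ℝ := BoundedContinuousFunction.ofNormedAddCommGroup
    (K.domRestrict f) (continuousOn_iff_continuous_domRestrict.1 (hf R hR)) M fun s => hM s
  -- Tietze without increase of the norm, so that `M` still bounds `g` off `K`.
  obtain ⟨g, hg, hgF⟩ := F.exists_norm_eq_domRestrict_eq_of_closed
    (ψ.isCompact_sublevel' R hR).isClosed
  have hgM : ∀ s, ‖g s‖ ≤ M := fun s => (g.norm_coe_le_norm s).trans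
    (hg ▸ BoundedContinuousFunction.norm_ofNormedAddCommGroup_le _ hM0 _)
  refine ⟨⟨⟨g, mem_weightedBoundedSubmodule_of_bounded ψ g M hgM⟩,
    subset_closure ⟨g.continuous, M, hgM⟩⟩, ?_⟩
  refine WeightedBounded.norm_sub_le_of_sublevel (R := R) (η := 0) (M := M) hη.le hM hgM hψ
    (by positivity) ?_ fun s hs => ?_
  · rw [← div_le_iff₀' hη]
    exact le_max_right _ _
  · have h : g s = f s := DFunLike.congr_fun hgF ⟨s, hs⟩
    change ‖f s - g s‖ ≤ 0
    rw [h, sub_self, norm_zero]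

end Weighted

/-! ### Kernels that respect the weight -/

section KernelSemigroup

/-- A process that is measurable in space and right continuous in time is jointly measurable. -/
theorem measurable_uncurry_of_rightContinuous {S : Type*} [MeasurableSpace S] {u : ℝ≥0 → S → ℝ}
    (hu : ∀ t, Measurable (u t))
    (hr : ∀ s t, ContinuousWithinAt (fun r => u r s) (Set.Ici t) t) :
    Measurable (Function.uncurry u) := by
  -- For `m = ⌊(n + 1) t⌋` the grid point lies in `(t, t + 1 / (n + 1)]`; the numerator `m + 1`
  -- approaches `t` from the right.
  obtain ⟨b, hb⟩ : ∃ b : ℕ → ℕ → ℝ≥0, ∀ n m, b n m = ((m : ℝ≥0) + 1) / ((n : ℝ≥0) + 1) :=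
    ⟨_, fun _ _ => rfl⟩
  have h1 : ∀ n : ℕ, Measurable fun p : ℝ≥0 × S => u (b n ⌊((n : ℝ≥0) + 1) * p.1⌋₊) p.2 := by
    intro n
    have h2 : Measurable fun q : ℕ × S => u (b n q.1) q.2 :=
      measurable_from_prod_countable_right fun m => hu (b n m)
    have h3 : Measurable fun p : ℝ≥0 × S => (⌊((n : ℝ≥0) + 1) * p.1⌋₊, p.2) :=
      (Nat.measurable_floor.comp (measurable_fst.const_mul _)).prodMk measurable_snd
    exact h2.comp h3
  refine measurable_of_tendsto_metrizable h1 (tendsto_pi_nhds.2 fun p => ?_)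
  refine Tendsto.comp (hr p.2 p.1) (tendsto_nhdsWithin_iff.2 ⟨?_, Eventually.of_forall fun n => ?_⟩)
  · have hlim : Tendsto (fun n : ℕ => p.1 + 1 / ((n : ℝ≥0) + 1)) atTop (𝓝 (p.1 + 0)) :=
      tendsto_const_nhds.add tendsto_one_div_add_atTop_nhds_zero_nat
    rw [add_zero] at hlim
    refine tendsto_of_tendsto_of_tendsto_of_le_of_le tendsto_const_nhds hlim (fun n => ?_)
      fun n => ?_
    · rw [hb, le_div_iff₀ (by positivity), mul_comm]
      exact (Nat.lt_floor_add_one _).le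
    · have h0 : ((n : ℝ≥0) + 1) ≠ 0 := by positivity
      rw [hb, div_le_iff₀ (by positivity), add_mul p.1, div_mul_cancel₀ _ h0, mul_comm p.1]
      gcongr
      exact Nat.floor_le (by positivity)
  · rw [Set.mem_Ici, hb, le_div_iff₀ (by positivity), mul_comm]
    exact (Nat.lt_floor_add_one _).le

variable {S : Type*} [TopologicalSpace S] [MeasurableSpace S] {ψ : AdmissibleWeight S}

/-- The kernel `κ` increases the weight at most by the factor `c`. -/
def ProbabilityTheory.Kernel.WeightBound (κ : ProbabilityTheory.Kernel S S)
    (ψ : AdmissibleWeight S) (c : ℝ) : Prop :=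
  ∀ s, ∫⁻ s', ENNReal.ofReal (ψ s') ∂(κ s) ≤ ENNReal.ofReal (c * ψ s)

namespace ProbabilityTheory.Kernel

variable {κ η : Kernel S S} {c d : ℝ}

theorem WeightBound.mono (h : κ.WeightBound ψ c) (hcd : c ≤ d) : κ.WeightBound ψ d := fun s =>
  (h s).trans (ENNReal.ofReal_le_ofReal (mul_le_mul_of_nonneg_right hcd (ψ.pos' s).le))

end ProbabilityTheory.Kernel

variable [OpensMeasurableSpace S]

/-- Sublevel sets are compact, hence closed, for positive levels and empty otherwise. -/
theorem AdmissibleWeight.measurable [T2Space S] (ψ : AdmissibleWeight S) :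
    Measurable (ψ : S → ℝ) := by
  refine measurable_of_Iic fun R => ?_
  rcases lt_or_ge 0 R with hR | hR
  · exact (ψ.isCompact_sublevel' R hR).isClosed.measurableSet
  · convert MeasurableSet.empty (α := S)
    exact Set.eq_empty_of_forall_notMem fun s hs => (hR.trans_lt (ψ.pos' s)).not_ge hs

theorem GrowthControlled.measurable (f : GrowthControlled ψ) : Measurable (f.1 : S → ℝ) := by
  have hpos : ∀ n : ℕ, (0 : ℝ) < 1 / ((n : ℝ) + 1) := fun n => by positivity
  choose g hg _ hfg using fun n : ℕ => f.exists_approx (hpos n)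
  refine measurable_of_tendsto_metrizable (fun n => (hg n).measurable) (tendsto_pi_nhds.2 fun s => ?_)
  rw [tendsto_iff_norm_sub_tendsto_zero]
  have hlim : Tendsto (fun n : ℕ => 1 / ((n : ℝ) + 1) * ψ s) atTop (𝓝 0) := by
    simpa using tendsto_one_div_add_atTop_nhds_zero_nat.mul_const (ψ s)
  refine squeeze_zero (fun _ => norm_nonneg _) (fun n => ?_) hlim
  rw [norm_sub_rev]
  exact ((f - g n).norm_apply_le s).trans
    (mul_le_mul_of_nonneg_right (hfg n).le (ψ.pos' s).le)

namespace ProbabilityTheory.Kernel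

variable {κ η : Kernel S S} {c d : ℝ}

variable [T2Space S]

theorem WeightBound.comp (hκ : κ.WeightBound ψ c) (hη : η.WeightBound ψ d) (hd : 0 ≤ d) :
    (η ∘ₖ κ).WeightBound ψ (d * c) := by
  intro s
  have hm : Measurable fun s => ENNReal.ofReal (ψ s) := ψ.measurable.ennreal_ofReal
  calc ∫⁻ s', ENNReal.ofReal (ψ s') ∂((η ∘ₖ κ) s)
      = ∫⁻ s₁, ∫⁻ s₂, ENNReal.ofReal (ψ s₂) ∂(η s₁) ∂(κ s) := lintegral_comp _ _ _ hm
    _ ≤ ∫⁻ s₁, ENNReal.ofReal (d * ψ s₁) ∂(κ s) := lintegral_mono fun s₁ => hη s₁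
    _ = ENNReal.ofReal d * ∫⁻ s₁, ENNReal.ofReal (ψ s₁) ∂(κ s) := by
        simp_rw [ENNReal.ofReal_mul hd]
        exact lintegral_const_mul _ hm
    _ ≤ ENNReal.ofReal d * ENNReal.ofReal (c * ψ s) := by gcongr; exact hκ s
    _ = ENNReal.ofReal (d * c * ψ s) := by rw [← ENNReal.ofReal_mul hd, mul_assoc]

theorem WeightBound.integrable_weight (hκ : κ.WeightBound ψ c) (s : S) :
    Integrable (ψ : S → ℝ) (κ s) := by
  refine ⟨ψ.measurable.aestronglyMeasurable, ?_⟩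
  rw [hasFiniteIntegral_iff_ofReal (Eventually.of_forall fun s => (ψ.pos' s).le)]
  exact (hκ s).trans_lt ENNReal.ofReal_lt_top

theorem WeightBound.integral_weight_le (hκ : κ.WeightBound ψ c) (hc : 0 ≤ c) (s : S) :
    ∫ s', ψ s' ∂(κ s) ≤ c * ψ s := by
  rw [integral_eq_lintegral_of_nonneg_ae (Eventually.of_forall fun s => (ψ.pos' s).le)
    ψ.measurable.aestronglyMeasurable]
  exact ENNReal.toReal_le_of_le_ofReal (mul_nonneg hc (ψ.pos' s).le) (hκ s)

theorem WeightBound.integrable (hκ : κ.WeightBound ψ c) (f : GrowthControlled ψ) (s : S) :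
    Integrable (f.1 : S → ℝ) (κ s) :=
  ((hκ.integrable_weight s).const_mul ‖f‖).mono' f.measurable.aestronglyMeasurable
    (Eventually.of_forall f.norm_apply_le)

theorem WeightBound.norm_integral_le (hκ : κ.WeightBound ψ c) (hc : 0 ≤ c)
    (f : GrowthControlled ψ) (s : S) : ‖∫ s', f.1 s' ∂(κ s)‖ ≤ c * ‖f‖ * ψ s :=
  calc ‖∫ s', f.1 s' ∂(κ s)‖ ≤ ∫ s', ‖f‖ * ψ s' ∂(κ s) :=
        norm_integral_le_of_norm_le ((hκ.integrable_weight s).const_mul ‖f‖)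
          (Eventually.of_forall f.norm_apply_le)
    _ = ‖f‖ * ∫ s', ψ s' ∂(κ s) := integral_const_mul _ _
    _ ≤ ‖f‖ * (c * ψ s) :=
        mul_le_mul_of_nonneg_left (hκ.integral_weight_le hc s) (norm_nonneg _)
    _ = c * ‖f‖ * ψ s := by ring

theorem WeightBound.opNorm_le (hκ : κ.WeightBound ψ c) (hc : 0 ≤ c)
    (T : GrowthControlled ψ →L[ℝ] GrowthControlled ψ)
    (hT : ∀ f s, (T f).1 s = ∫ s', f.1 s' ∂(κ s)) : ‖T‖ ≤ c := by
  refine T.opNorm_le_bound hc fun f => GrowthControlled.norm_le (by positivity) fun s => ?_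
  rw [hT]
  exact hκ.norm_integral_le hc f s

/-- A kernel that respects the weight induces a bounded operator on `𝓑^ψ` as soon as it maps a
dense set of functions to `𝓑^ψ`. -/
theorem WeightBound.exists_operator (hκ : κ.WeightBound ψ c) (hc : 0 ≤ c)
    (hdense : ∀ g : GrowthControlled ψ, Continuous (g.1 : S → ℝ) → (∃ M : ℝ, ∀ s, ‖g.1 s‖ ≤ M) →
      ∀ η : ℝ, 0 < η → ∃ h k : GrowthControlled ψ, ‖g - h‖ ≤ η ∧
        ∀ s, k.1 s = ∫ s', h.1 s' ∂(κ s)) :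
    ∃ T : GrowthControlled ψ →L[ℝ] GrowthControlled ψ,
      ∀ f s, (T f).1 s = ∫ s', f.1 s' ∂(κ s) := by
  let T₀ : GrowthControlled ψ →ₗ[ℝ] WeightedBounded ψ :=
    { toFun := fun f => ⟨fun s => ∫ s', f.1 s' ∂(κ s), by
        refine ⟨c * ‖f‖, ?_⟩
        rintro _ ⟨s, rfl⟩
        change (ψ s)⁻¹ * _ ≤ _
        rw [inv_mul_eq_div, div_le_iff₀ (ψ.pos' s)]
        exact hκ.norm_integral_le hc f s⟩
      map_add' := fun f g => Subtype.ext (funext fun s =>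
        integral_add (hκ.integrable f s) (hκ.integrable g s))
      map_smul' := fun a f => Subtype.ext (funext fun s => integral_const_mul a _) }
  have hT₀ : ∀ f, ‖T₀ f‖ ≤ c * ‖f‖ := fun f =>
    WeightedBounded.norm_le (by positivity) fun s => hκ.norm_integral_le hc f s
  have hmem : ∀ f, T₀ f ∈ (boundedContinuousSubmodule ψ).topologicalClosure := by
    refine fun f => mem_closure_of_approx fun η hη => ?_
    -- Two errors of this size add up to `η / (c + 1)`, and `T₀` magnifies by at most `c`; `c + 1`
    -- covers `c = 0`.
    have hη' : 0 < η / (2 * (c + 1)) := by positivity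
    obtain ⟨g, hg, hgM, hfg⟩ := f.exists_approx hη'
    obtain ⟨h, k, hgh, hk⟩ := hdense g hg hgM _ hη'
    refine ⟨k, ?_⟩
    have hk' : k.1 = T₀ h := Subtype.ext (funext hk)
    rw [hk', ← map_sub]
    have h1 : ‖f - h‖ ≤ η / (c + 1) := by
      have h2 : η / (2 * (c + 1)) + η / (2 * (c + 1)) = η / (c + 1) := by
        field_simp
        norm_num
      linarith [norm_sub_le_norm_sub_add_norm_sub f g h]
    calc ‖T₀ (f - h)‖ ≤ c * ‖f - h‖ := hT₀ _
      _ ≤ (c + 1) * (η / (c + 1)) := by gcongr; linarith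
      _ = η := by field_simp
  exact ⟨(T₀.codRestrict _ hmem).mkContinuous c hT₀, fun f s => rfl⟩

end ProbabilityTheory.Kernel
end KernelSemigroup

/-! ### Strong continuity through time averages -/

section StrongContinuity

open ProbabilityTheory

variable {S : Type*} [TopologicalSpace S] {ψ : AdmissibleWeight S}

/-- Restriction of functions in `𝓑^ψ` to a sublevel set of the weight. -/
noncomputable def GrowthControlled.restrict (R : ℝ) (hR : 0 < R) :
    GrowthControlled ψ →ₗ[ℝ] C({s | ψ s ≤ R}, ℝ) where
  toFun f := ⟨{s | ψ s ≤ R}.domRestrict (f.1 : S → ℝ),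
    continuousOn_iff_continuous_domRestrict.1 (f.continuousOn R hR)⟩
  map_add' _ _ := rfl
  map_smul' _ _ := rfl

/-- Pointwise bounded convergence of a sequence in a convex subset of `𝓑^ψ` gives approximation in
norm by elements of the convex set. -/
theorem GrowthControlled.exists_mem_norm_sub_le [T2Space S] {C : Set (GrowthControlled ψ)}
    (hC : Convex ℝ C) {M : ℝ} (hCM : ∀ g ∈ C, ∀ s, ‖g.1 s‖ ≤ M) {u : ℕ → GrowthControlled ψ}
    (hu : ∀ n, u n ∈ C) {f : GrowthControlled ψ} (hf : ∀ s, ‖f.1 s‖ ≤ M)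
    (huf : ∀ s, Tendsto (fun n => (u n).1 s) atTop (𝓝 (f.1 s))) {η : ℝ} (hη : 0 < η) :
    ∃ g ∈ C, ‖f - g‖ ≤ η := by
  obtain ⟨δ, hδ, hψ⟩ := ψ.exists_pos_le
  let R := max 1 (2 * M / η)
  have hR : 0 < R := lt_max_of_lt_left one_pos
  have : CompactSpace {s | ψ s ≤ R} := isCompact_iff_compactSpace.1 (ψ.isCompact_sublevel' R hR)
  let ρ := GrowthControlled.restrict (ψ := ψ) R hR
  have hmem : ρ f ∈ closure (ρ '' C) :=
    (hC.linear_image ρ).mem_closure_of_tendsto_pointwise (u := fun n => ρ (u n)) (M := M)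
      (fun n => ⟨u n, hu n, rfl⟩) (fun n k => hCM _ (hu n) k) (fun k => huf k)
  obtain ⟨_, ⟨g, hg, rfl⟩, h⟩ := Metric.mem_closure_iff.1 hmem (η * δ) (by positivity)
  refine ⟨g, hg, WeightedBounded.norm_sub_le_of_sublevel (R := R) (η := η * δ) (M := M) hη.le hf
    (hCM g hg) hψ le_rfl ?_ fun s hs => ?_⟩
  · rw [← div_le_iff₀' hη]
    exact le_max_right _ _
  · have h1 := (ρ f - ρ g).norm_coe_le_norm ⟨s, hs⟩
    rw [dist_eq_norm] at h
    exact h1.trans h.le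

variable [MeasurableSpace S] [OpensMeasurableSpace S] [T2Space S] [RegularSpace S]

/-- The averages `h⁻¹ ∫₀ʰ P_r f dr` of a semigroup along the orbit of a bounded continuous function
belong to `𝓑^ψ`, converge pointwise to `f` and are asymptotically invariant. -/
theorem exists_time_average {κ : ℝ≥0 → Kernel S S} [∀ t, IsMarkovKernel (κ t)]
    (hκ_add : ∀ s t, κ (s + t) = κ t ∘ₖ κ s)
    {P : ℝ≥0 → GrowthControlled ψ →L[ℝ] GrowthControlled ψ}
    (hP : ∀ t f s, (P t f).1 s = ∫ s', f.1 s' ∂(κ t s))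
    (hK : ∀ R : ℝ, 0 < R → FirstCountableTopology {s | ψ s ≤ R})
    {f : GrowthControlled ψ} {M : ℝ} (hM : ∀ s, ‖f.1 s‖ ≤ M)
    (hf : ∀ s t, ContinuousWithinAt (fun r : ℝ≥0 => (P r f).1 s) (Set.Ici t) t) (h : ℝ)
    (hh : 0 < h) :
    ∃ g : GrowthControlled ψ, (∀ s, ‖g.1 s‖ ≤ M) ∧
      Tendsto (fun t : ℝ≥0 => ‖P t g - g‖) (𝓝[>] 0) (𝓝 0) ∧
      ∀ s, g.1 s = h⁻¹ * ∫ r in (0 : ℝ)..h, (P r.toNNReal f).1 s := by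
  obtain ⟨δ, hδ, hψ⟩ := ψ.exists_pos_le
  rcases isEmpty_or_nonempty S with hS | ⟨⟨s₀⟩⟩
  · refine ⟨0, hS.elim, ?_, hS.elim⟩
    simp
  have hM0 : 0 ≤ M := (norm_nonneg _).trans (hM s₀)
  have hPM : ∀ t s, ‖(P t f).1 s‖ ≤ M := by
    intro t s
    rw [hP]
    simpa using norm_integral_le_of_norm_le_const (μ := κ t s) (Eventually.of_forall hM)
  have hjoint : Measurable fun p : ℝ × S => (P p.1.toNNReal f).1 p.2 :=
    (measurable_uncurry_of_rightContinuous (u := fun t s => (P t f).1 s)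
      (fun t => (P t f).measurable) hf).comp
      ((measurable_real_toNNReal.comp measurable_fst).prodMk measurable_snd)
  have htime : ∀ s, Measurable fun r : ℝ => (P r.toNNReal f).1 s := fun s =>
    hjoint.comp (measurable_id.prodMk measurable_const)
  have hint : ∀ s a b, IntervalIntegrable (fun r : ℝ => (P r.toNNReal f).1 s) volume a b :=
    fun s a b => (intervalIntegrable_const (c := M)).mono_fun (htime s).aestronglyMeasurable
      (Eventually.of_forall fun r => (hPM _ s).trans (le_abs_self M))
  let G : S → ℝ := fun s => h⁻¹ * ∫ r in (0 : ℝ)..h, (P r.toNNReal f).1 s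
  have hGM : ∀ s, ‖G s‖ ≤ M := by
    intro s
    have h1 := intervalIntegral.norm_integral_le_of_norm_le_const (a := 0) (b := h)
      fun r _ => hPM r.toNNReal s
    rw [sub_zero, abs_of_pos hh] at h1
    rw [norm_mul, norm_inv, Real.norm_of_nonneg hh.le, inv_mul_le_iff₀ hh, mul_comm h]
    exact h1
  have hGc : ∀ R : ℝ, 0 < R → ContinuousOn G {s | ψ s ≤ R} := by
    intro R hR
    -- Continuity of a parameter integral by dominated convergence needs countably generated
    -- neighbourhood filters.
    have := hK R hR
    rw [continuousOn_iff_continuous_domRestrict]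
    refine Continuous.const_mul ?_ _
    refine intervalIntegral.continuous_of_dominated_interval (bound := fun _ => M)
      (fun s => (htime s).aestronglyMeasurable)
      (fun s => Eventually.of_forall fun r _ => hPM _ s) intervalIntegrable_const
      (Eventually.of_forall fun r _ => ?_)
    exact continuousOn_iff_continuous_domRestrict.1 ((P r.toNNReal f).continuousOn R hR)
  let g : GrowthControlled ψ :=
    ⟨⟨G, mem_weightedBoundedSubmodule_of_bounded ψ G M hGM⟩, mem_closure_of_continuousOn hGM hGc⟩
  -- Fubini and the semigroup law: `P t` moves the averaging window from `[0, h]` to `[t, t + h]`.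
  have hshift : ∀ t s, (P t g).1 s = h⁻¹ * ∫ r in (t : ℝ)..(t + h), (P r.toNNReal f).1 s := by
    intro t s
    rw [hP]
    change ∫ s', h⁻¹ * (∫ r in (0 : ℝ)..h, (P r.toNNReal f).1 s') ∂(κ t s) = _
    rw [integral_const_mul]
    congr 1
    simp_rw [intervalIntegral.integral_of_le hh.le]
    rw [integral_integral_swap]
    · rw [← intervalIntegral.integral_of_le hh.le]
      have h1 := intervalIntegral.integral_comp_add_left (a := 0) (b := h)
        (fun r : ℝ => (P r.toNNReal f).1 s) (t : ℝ)
      rw [add_zero] at h1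
      rw [← h1]
      refine intervalIntegral.integral_congr fun r hr => ?_
      rw [Set.uIcc_of_le hh.le] at hr
      have h2 : ((t : ℝ) + r).toNNReal = t + r.toNNReal := by
        rw [Real.toNNReal_add t.coe_nonneg hr.1, Real.toNNReal_coe]
      change ∫ s', (P r.toNNReal f).1 s' ∂(κ t s) = (P ((t : ℝ) + r).toNNReal f).1 s
      rw [h2, hP, hκ_add, Kernel.integral_comp]
      · simp_rw [hP]
      · exact (integrable_const M).mono' f.measurable.aestronglyMeasurable
          (Eventually.of_forall hM)
    · exact (integrable_const M).mono' (hjoint.comp measurable_swap).aestronglyMeasurable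
        (Eventually.of_forall fun p => hPM _ _)
  refine ⟨g, hGM, ?_, fun s => rfl⟩
  -- The two windows leave two pieces of length `t`, each contributing at most `M * t`; `δ⁻¹`
  -- converts the uniform bound to the weighted norm.
  have hbound : ∀ t : ℝ≥0, ‖P t g - g‖ ≤ h⁻¹ * (2 * M * t) * δ⁻¹ := by
    intro t
    refine GrowthControlled.norm_le (by positivity) fun s => ?_
    have h1 : ‖(P t g).1 s - g.1 s‖ ≤ h⁻¹ * (2 * M * t) := by
      have h2 : (P t g).1 s - g.1 s = h⁻¹ * ((∫ r in (h : ℝ)..(t + h), (P r.toNNReal f).1 s) -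
          ∫ r in (0 : ℝ)..t, (P r.toNNReal f).1 s) := by
        rw [hshift]
        change _ - h⁻¹ * _ = _
        rw [← mul_sub, intervalIntegral.integral_interval_sub_interval_comm (hint s _ _)
          (hint s _ _) (hint s _ _), ← neg_sub, intervalIntegral.integral_symm h]
        rw [intervalIntegral.integral_symm 0 (t : ℝ)]
        ring
      rw [h2, norm_mul, norm_inv, Real.norm_of_nonneg hh.le]
      refine mul_le_mul_of_nonneg_left ?_ (by positivity)
      have h3 := intervalIntegral.norm_integral_le_of_norm_le_const (a := h) (b := t + h)
        fun r _ => hPM r.toNNReal s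
      have h4 := intervalIntegral.norm_integral_le_of_norm_le_const (a := 0) (b := t)
        fun r _ => hPM r.toNNReal s
      rw [add_sub_cancel_right, abs_of_nonneg t.coe_nonneg] at h3
      rw [sub_zero, abs_of_nonneg t.coe_nonneg] at h4
      refine (norm_sub_le _ _).trans ((add_le_add h3 h4).trans (le_of_eq ?_))
      ring
    calc ‖(P t g).1 s - g.1 s‖ ≤ h⁻¹ * (2 * M * t) * 1 := by rwa [mul_one]
      _ ≤ h⁻¹ * (2 * M * t) * (δ⁻¹ * ψ s) := by
        refine mul_le_mul_of_nonneg_left ?_ (by positivity)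
        rw [inv_mul_eq_div, le_div_iff₀ hδ, one_mul]
        exact hψ s
      _ = h⁻¹ * (2 * M * t) * δ⁻¹ * ψ s := by ring
  refine squeeze_zero (fun _ => norm_nonneg _) hbound (tendsto_nhdsWithin_of_tendsto_nhds ?_)
  have hcont : Continuous fun t : ℝ≥0 => h⁻¹ * (2 * M * t) * δ⁻¹ := by fun_prop
  simpa using hcont.tendsto 0

/-- Averages over shrinking intervals converge to the value from the right. -/
theorem tendsto_average_of_rightContinuous {φ : ℝ → ℝ}
    (hφ : ∀ h, IntervalIntegrable φ volume 0 h) (hc : ContinuousWithinAt φ (Set.Ici 0) 0) :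
    Tendsto (fun h : ℝ => h⁻¹ * ∫ r in (0 : ℝ)..h, φ r) (𝓝[>] 0) (𝓝 (φ 0)) := by
  rw [Metric.tendsto_nhds]
  intro η hη
  obtain ⟨ρ, hρ, hφρ⟩ := Metric.continuousWithinAt_iff.1 hc (η / 2) (by linarith)
  filter_upwards [Ioo_mem_nhdsGT hρ] with h hh
  have h1 : h⁻¹ * (∫ r in (0 : ℝ)..h, φ r) - φ 0 = h⁻¹ * ∫ r in (0 : ℝ)..h, (φ r - φ 0) := by
    rw [intervalIntegral.integral_sub (hφ h) intervalIntegrable_const,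
      intervalIntegral.integral_const, sub_zero, smul_eq_mul, mul_sub, inv_mul_cancel_left₀ hh.1.ne']
  have h2 : ‖∫ r in (0 : ℝ)..h, (φ r - φ 0)‖ ≤ η / 2 * |h - 0| := by
    refine intervalIntegral.norm_integral_le_of_norm_le_const fun r hr => ?_
    rw [Set.uIoc_of_le hh.1.le] at hr
    rw [← dist_eq_norm]
    refine (hφρ hr.1.le ?_).le
    rw [Real.dist_eq, sub_zero, abs_of_pos hr.1]
    exact hr.2.trans_lt hh.2
  rw [dist_eq_norm, h1, norm_mul, norm_inv, Real.norm_of_nonneg hh.1.le, inv_mul_lt_iff₀ hh.1]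
  rw [sub_zero, abs_of_pos hh.1] at h2
  nlinarith [hh.1]

/-- A generalised Feller semigroup given by Markov kernels, right continuous along the orbits of
bounded continuous functions, is strongly continuous. -/
theorem isStronglyContinuousAtZero_of_kernel {κ : ℝ≥0 → Kernel S S} [∀ t, IsMarkovKernel (κ t)]
    (hκ_add : ∀ s t, κ (s + t) = κ t ∘ₖ κ s)
    {P : ℝ≥0 → GrowthControlled ψ →L[ℝ] GrowthControlled ψ}
    (hP : ∀ t f s, (P t f).1 s = ∫ s', f.1 s' ∂(κ t s))
    (hK : ∀ R : ℝ, 0 < R → FirstCountableTopology {s | ψ s ≤ R})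
    (hP₀ : P 0 = ContinuousLinearMap.id ℝ _)
    (hbdd : ∃ C : ℝ, ∃ ε : ℝ≥0, 0 < ε ∧ ∀ t ≤ ε, ‖P t‖ ≤ C)
    (hcont : ∀ f : GrowthControlled ψ, Continuous (f.1 : S → ℝ) → (∃ M : ℝ, ∀ s, ‖f.1 s‖ ≤ M) →
      ∀ s t, ContinuousWithinAt (fun r : ℝ≥0 => (P r f).1 s) (Set.Ici t) t) :
    IsStronglyContinuousAtZero P := by
  obtain ⟨C, ε, hε, hC⟩ := hbdd
  have hC0 : 0 ≤ C := (P 0).opNorm_nonneg.trans (hC 0 zero_le)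
  have hdense : ∀ (f : GrowthControlled ψ) (η : ℝ), 0 < η → ∃ g : GrowthControlled ψ,
      Tendsto (fun t : ℝ≥0 => ‖P t g - g‖) (𝓝[>] 0) (𝓝 0) ∧ ‖f - g‖ ≤ η := by
    intro f η hη
    obtain ⟨f₁, hf₁, ⟨M, hM⟩, hff₁⟩ := f.exists_approx (half_pos hη)
    -- The bound `M` is part of `A`, since the passage from pointwise to norm approximation needs it
    -- off the sublevel sets.
    let A : Set (GrowthControlled ψ) := {g | (∀ s, ‖g.1 s‖ ≤ M) ∧
      Tendsto (fun t : ℝ≥0 => ‖P t g - g‖) (𝓝[>] 0) (𝓝 0)}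
    have hA : Convex ℝ A := by
      intro g hg k hk a b ha hb hab
      refine ⟨fun s => ?_, ?_⟩
      · change ‖a * g.1 s + b * k.1 s‖ ≤ M
        calc ‖a * g.1 s + b * k.1 s‖ ≤ a * ‖g.1 s‖ + b * ‖k.1 s‖ := by
              refine (norm_add_le _ _).trans (le_of_eq ?_)
              rw [norm_mul, norm_mul, Real.norm_of_nonneg ha, Real.norm_of_nonneg hb]
          _ ≤ a * M + b * M := by gcongr; exacts [hg.1 s, hk.1 s]
          _ = M := by rw [← add_mul, hab, one_mul]
      · have hlim := (hg.2.const_mul a).add (hk.2.const_mul b)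
        rw [mul_zero, mul_zero, add_zero] at hlim
        refine squeeze_zero (fun _ => norm_nonneg _) (fun t => ?_) hlim
        have h1 : P t (a • g + b • k) - (a • g + b • k) = a • (P t g - g) + b • (P t k - k) := by
          rw [map_add, map_smul, map_smul, smul_sub, smul_sub]
          abel
        rw [h1]
        refine (norm_add_le _ _).trans (le_of_eq ?_)
        rw [norm_smul, norm_smul, Real.norm_of_nonneg ha, Real.norm_of_nonneg hb]
    have hf₁c := hcont f₁ hf₁ ⟨M, hM⟩
    have hpos : ∀ n : ℕ, (0 : ℝ) < 1 / ((n : ℝ) + 1) := fun n => by positivity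
    choose u huM hu hu' using fun n : ℕ => exists_time_average hκ_add hP hK hM
      hf₁c _ (hpos n)
    have huf : ∀ s, Tendsto (fun n => (u n).1 s) atTop (𝓝 (f₁.1 s)) := by
      intro s
      let φ : ℝ → ℝ := fun r => (P r.toNNReal f₁).1 s
      have hφ0 : φ 0 = f₁.1 s := by
        change (P (Real.toNNReal 0) f₁).1 s = _
        rw [Real.toNNReal_zero, hP₀]
        rfl
      have hφm : Measurable φ :=
        ((measurable_uncurry_of_rightContinuous (u := fun t s => (P t f₁).1 s)
          (fun t => (P t f₁).measurable) hf₁c).comp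
          (measurable_id.prodMk measurable_const)).comp measurable_real_toNNReal
      have hφM : ∀ r, ‖φ r‖ ≤ M := by
        intro r
        change ‖(P r.toNNReal f₁).1 s‖ ≤ M
        rw [hP]
        simpa using norm_integral_le_of_norm_le_const (μ := κ r.toNNReal s)
          (Eventually.of_forall hM)
      have hφi : ∀ h, IntervalIntegrable φ volume 0 h := fun h =>
        (intervalIntegrable_const (c := M)).mono_fun hφm.aestronglyMeasurable
          (Eventually.of_forall fun r => (hφM r).trans (le_abs_self M))
      have hφc : ContinuousWithinAt φ (Set.Ici 0) 0 := by
        have h1 : ContinuousWithinAt (fun r : ℝ≥0 => (P r f₁).1 s) (Set.Ici (Real.toNNReal 0))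
            (Real.toNNReal 0) := hf₁c s _
        exact h1.comp continuous_real_toNNReal.continuousWithinAt
          fun r _ => Real.toNNReal_le_toNNReal ‹_›
      have hlim : Tendsto (fun n : ℕ => 1 / ((n : ℝ) + 1)) atTop (𝓝[>] 0) :=
        tendsto_nhdsWithin_iff.2 ⟨tendsto_one_div_add_atTop_nhds_zero_nat,
          Eventually.of_forall hpos⟩
      have h2 := (tendsto_average_of_rightContinuous hφi hφc).comp hlim
      rw [hφ0] at h2
      exact h2.congr fun n => (hu' n s).symm
    obtain ⟨g, hg, hfg⟩ := GrowthControlled.exists_mem_norm_sub_le hA (fun g hg => hg.1)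
      (fun n => ⟨huM n, hu n⟩) hM huf (half_pos hη)
    refine ⟨g, hg.2, ?_⟩
    linarith [norm_sub_le_norm_sub_add_norm_sub f f₁ g]
  intro f
  rw [Metric.tendsto_nhds]
  intro η hη
  -- `P t (f - g)` and `f - g` together cost at most `(C + 1) * ‖f - g‖ ≤ η / 2`; the rest is left
  -- for `P t g - g`.
  obtain ⟨g, hg, hfg⟩ := hdense f (η / (2 * (C + 1))) (by positivity)
  have hε' : ∀ᶠ t : ℝ≥0 in 𝓝[>] 0, t ≤ ε :=
    tendsto_nhdsWithin_of_tendsto_nhds tendsto_id (Iic_mem_nhds hε)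
  filter_upwards [hε', hg.eventually (gt_mem_nhds (half_pos hη))] with t ht hgt
  rw [Real.dist_eq, sub_zero, abs_of_nonneg (norm_nonneg _)]
  have h1 : P t f - f = P t (f - g) + (P t g - g) - (f - g) := by
    rw [map_sub]
    abel
  have h2 : ‖P t (f - g)‖ ≤ C * ‖f - g‖ := (P t).le_of_opNorm_le (hC t ht) _
  have h3 : (C + 1) * ‖f - g‖ ≤ η / 2 := by
    calc (C + 1) * ‖f - g‖ ≤ (C + 1) * (η / (2 * (C + 1))) := by gcongr
      _ = η / 2 := by field_simp
  rw [h1]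
  linarith [norm_sub_le (P t (f - g) + (P t g - g)) (f - g), norm_add_le (P t (f - g)) (P t g - g)]

end StrongContinuity

/-! ### Transition kernels of Markov processes -/

section MarkovProcess

open ProbabilityTheory

namespace IsMarkovProcess

variable {Ω E : Type*} [MeasurableSpace E] {mΩ : MeasurableSpace Ω} {μ : Measure Ω}
  {ℱ : Filtration ℝ≥0 mΩ} {x : ℝ≥0 → E → Ω → E}

theorem measurable (hx : IsMarkovProcess μ ℱ x) (t : ℝ≥0) (e : E) : Measurable (x t e) :=
  (hx.adapted t e).mono (ℱ.le t) le_rfl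

/-- Transport of a Markov process along a measurable equivalence of state spaces. -/
theorem map_equiv (hx : IsMarkovProcess μ ℱ x) {F : Type*} [MeasurableSpace F] (φ : E ≃ᵐ F) :
    IsMarkovProcess μ ℱ fun t a ω => φ (x t (φ.symm a) ω) where
  adapted t a := φ.measurable.comp (hx.adapted t _)
  start a := by
    filter_upwards [hx.start (φ.symm a)] with ω hω
    rw [hω, φ.apply_symm_apply]
  measurable_transition t A hA :=
    (hx.measurable_transition t (φ ⁻¹' A) (φ.measurable hA)).comp φ.symm.measurable
  markov s t a A hA := by
    filter_upwards [hx.markov s t (φ.symm a) (φ ⁻¹' A) (φ.measurable hA)] with ω hω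
    rw [φ.symm_apply_apply]
    exact hω

/-- The transition kernels of a Markov process. -/
noncomputable def kernel (hx : IsMarkovProcess μ ℱ x) [IsProbabilityMeasure μ] (t : ℝ≥0) :
    Kernel E E where
  toFun e := μ.map (x t e)
  measurable' := Measure.measurable_of_measurable_coe _ fun A hA => by
    simp_rw [Measure.map_apply (hx.measurable t _) hA]
    exact hx.measurable_transition t A hA

variable [IsProbabilityMeasure μ] (hx : IsMarkovProcess μ ℱ x)

theorem kernel_apply (t : ℝ≥0) (e : E) : hx.kernel t e = μ.map (x t e) := rfl

instance (t : ℝ≥0) : IsMarkovKernel (hx.kernel t) :=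
  ⟨fun e => Measure.isProbabilityMeasure_map (hx.measurable t e).aemeasurable⟩

theorem kernel_zero : hx.kernel 0 = Kernel.id := by
  ext1 e
  rw [kernel_apply, Measure.map_congr (show x 0 e =ᵐ[μ] fun _ => e from hx.start e),
    Measure.map_const, measure_univ, one_smul, Kernel.id_apply]

/-- The Chapman-Kolmogorov equation. -/
theorem kernel_add (s t : ℝ≥0) : hx.kernel (s + t) = hx.kernel t ∘ₖ hx.kernel s := by
  ext e A hA
  have hm : Measurable fun e' => hx.kernel t e' A := (hx.kernel t).measurable_coe hA
  rw [Kernel.comp_apply' _ _ _ hA, kernel_apply, kernel_apply, lintegral_map hm (hx.measurable s e)]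
  -- The Markov property is real valued, so both finite sides pass to real numbers; its expectation
  -- is then the claim.
  refine (ENNReal.toReal_eq_toReal_iff' (measure_ne_top _ _) ?_).1 ?_
  · refine ((lintegral_mono fun ω => prob_le_one).trans_lt ?_).ne (b := ∞)
    simp
  have hset : MeasurableSet {ω | x (s + t) e ω ∈ A} := hx.measurable _ _ hA
  rw [← integral_toReal (f := fun ω => hx.kernel t (x s e ω) A)
    (hm.comp (hx.measurable s e)).aemeasurable
    (Eventually.of_forall fun ω => measure_lt_top _ _), Measure.map_apply (hx.measurable _ _) hA]
  calc (μ (x (s + t) e ⁻¹' A)).toReal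
      = ∫ ω, {ω | x (s + t) e ω ∈ A}.indicator (fun _ => (1 : ℝ)) ω ∂μ := by
        rw [integral_indicator_const _ hset, smul_eq_mul, mul_one]
        rfl
    _ = ∫ ω, (μ[{ω | x (s + t) e ω ∈ A}.indicator (fun _ => (1 : ℝ)) | ℱ s]) ω ∂μ :=
        (integral_condExp (ℱ.le s)).symm
    _ = ∫ ω, μ.real {ω' | x t (x s e ω) ω' ∈ A} ∂μ := integral_congr_ae (hx.markov s t e A hA)
    _ = ∫ ω, (hx.kernel t (x s e ω) A).toReal ∂μ := by
        refine integral_congr_ae (Eventually.of_forall fun ω => ?_)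
        change (μ _).toReal = (μ.map _ A).toReal
        rw [Measure.map_apply (hx.measurable _ _) hA]
        rfl

end IsMarkovProcess

/-- A weight bound for small times propagates to all times along a semigroup of kernels. -/
theorem exists_weightBound_of_semigroup {S : Type*} [TopologicalSpace S] [T2Space S]
    [MeasurableSpace S] [OpensMeasurableSpace S] {ψ : AdmissibleWeight S} {κ : ℝ≥0 → Kernel S S}
    (hκ_add : ∀ s t, κ (s + t) = κ t ∘ₖ κ s) {C : ℝ} {ε : ℝ≥0} (hε : 0 < ε)
    (hC : ∀ t ≤ ε, (κ t).WeightBound ψ C) (t : ℝ≥0) : ∃ c : ℝ, 0 ≤ c ∧ (κ t).WeightBound ψ c := by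
  have hc : 0 ≤ max C 1 := zero_le_one.trans (le_max_right _ _)
  have key : ∀ (n : ℕ) (t : ℝ≥0), t ≤ (n + 1) * ε → (κ t).WeightBound ψ (max C 1 ^ (n + 1)) := by
    intro n
    induction n with
    | zero =>
      intro t ht
      rw [Nat.cast_zero, zero_add, one_mul] at ht
      simpa using (hC t ht).mono (le_max_left C 1)
    | succ n ih =>
      intro t ht
      -- Split off a step of length `min t ε`. For `t ≤ ε` the remainder is `0`, which the induction
      -- hypothesis also covers.
      rw [← add_tsub_cancel_of_le (min_le_left t ε), hκ_add, pow_succ]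
      refine ((hC _ (min_le_right t ε)).mono (le_max_left C 1)).comp (ih _ ?_) (pow_nonneg hc _)
      rw [tsub_le_iff_right]
      rcases le_total t ε with h | h
      · rw [min_eq_left h]
        exact le_add_of_nonneg_left zero_le
      · rw [min_eq_right h]
        refine ht.trans (le_of_eq ?_)
        push_cast
        ring
  obtain ⟨n, hn⟩ := exists_nat_ge (t / ε)
  refine ⟨_, pow_nonneg hc _, key n t ?_⟩
  rw [div_le_iff₀ hε] at hn
  exact hn.trans (mul_le_mul_of_nonneg_right (le_add_of_nonneg_right zero_le_one) zero_le)

end MarkovProcess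

/-! ### Measurable sets of the weak space -/

section WeakSpaceMeasurable

variable {Z : Type*} [NormedAddCommGroup Z] [NormedSpace ℝ Z] [MeasurableSpace Z]

/-- Transported from `Z`, so the process stays measurable; weakly open sets are measurable because
they are norm open. -/
noncomputable instance : MeasurableSpace (WeakSpace ℝ Z) :=
  MeasurableSpace.comap (toWeakSpace ℝ Z).symm inferInstance

/-- The identity as a measurable equivalence, the weak space carrying the same measurable sets. -/
noncomputable def toWeakSpaceMeasurableEquiv : Z ≃ᵐ WeakSpace ℝ Z where
  toEquiv := (toWeakSpace ℝ Z).toEquiv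
  measurable_toFun := measurable_comap_iff.2 measurable_id
  measurable_invFun := comap_measurable _

instance [OpensMeasurableSpace Z] : OpensMeasurableSpace (WeakSpace ℝ Z) :=
  ⟨MeasurableSpace.generateFrom_le fun U hU =>
    ⟨toWeakSpace ℝ Z ⁻¹' U, (hU.preimage (toWeakSpaceCLM ℝ Z).continuous).measurableSet, rfl⟩⟩

end WeakSpaceMeasurable

/-! ### Functions pulled back along a compact embedding -/

section CompactEmbedding

variable {Z : Type*} [NormedAddCommGroup Z] [NormedSpace ℝ Z]
  {X : Type*} [NormedAddCommGroup X] [NormedSpace ℝ X] {ι : Z →L[ℝ] X}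
  (ψ : AdmissibleWeight (WeakSpace ℝ Z))

/-- Bounded norm continuous functions pulled back along a compact operator belong to `𝓑^ψ`. -/
theorem IsCompactOperator.exists_growthControlled (hι : IsCompactOperator ι) {q : X → ℝ}
    (hq : Continuous q) {M : ℝ} (hM : ∀ a, ‖q a‖ ≤ M) :
    ∃ f : GrowthControlled ψ, ∀ w, f.1 w = q (ι ((toWeakSpace ℝ Z).symm w)) :=
  ⟨⟨⟨fun w => q (ι ((toWeakSpace ℝ Z).symm w)),
    mem_weightedBoundedSubmodule_of_bounded ψ _ M fun _ => hM _⟩,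
    mem_closure_of_continuousOn (fun _ => hM _) fun R hR =>
      hq.comp_continuousOn (hι.continuousOn_of_isCompact (ψ.isCompact_sublevel' R hR))⟩,
    fun _ => rfl⟩

variable {ψ}

/-- Bounded weakly continuous functions are approximated in `𝓑^ψ` by pull backs of bounded norm
continuous functions along an injective compact operator. -/
theorem IsCompactOperator.exists_boundedContinuous_approx (hι : IsCompactOperator ι)
    (hι_inj : Function.Injective ι) {g : GrowthControlled ψ}
    (hg : Continuous (g.1 : WeakSpace ℝ Z → ℝ)) {M : ℝ} (hM : ∀ w, ‖g.1 w‖ ≤ M) {η : ℝ}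
    (hη : 0 < η) :
    ∃ (q : BoundedContinuousFunction X ℝ) (f : GrowthControlled ψ), ‖g - f‖ ≤ η ∧
      ∀ w, f.1 w = q (ι ((toWeakSpace ℝ Z).symm w)) := by
  obtain ⟨δ, hδ, hψ⟩ := ψ.exists_pos_le
  let R := max 1 (2 * M / η)
  have hR : 0 < R := lt_max_of_lt_left one_pos
  have hM0 : 0 ≤ M := (norm_nonneg _).trans (hM 0)
  let F : BoundedContinuousFunction {w | ψ w ≤ R} ℝ :=
    BoundedContinuousFunction.ofNormedAddCommGroup (fun w => g.1 w.1)
      (hg.comp continuous_subtype_val) M fun w => hM w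
  -- Tietze in `X`, from the norm compact image of the sublevel set.
  obtain ⟨q, hq, hqF⟩ := F.exists_extension_norm_eq_of_isClosedEmbedding
    (hι.isClosedEmbedding_of_isCompact hι_inj (ψ.isCompact_sublevel' R hR))
  have hqM : ∀ a, ‖q a‖ ≤ M := fun a => (q.norm_coe_le_norm a).trans
    (hq ▸ BoundedContinuousFunction.norm_ofNormedAddCommGroup_le _ hM0 _)
  obtain ⟨f, hf⟩ := hι.exists_growthControlled ψ q.continuous hqM
  refine ⟨q, f, ?_, hf⟩
  refine WeightedBounded.norm_sub_le_of_sublevel (R := R) (η := 0) (M := M) hη.le hM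
    (fun w => by rw [hf]; exact hqM _) hψ (by positivity) ?_ fun w hw => ?_
  · rw [← div_le_iff₀' hη]
    exact le_max_right _ _
  · have h : q (ι ((toWeakSpace ℝ Z).symm w)) = g.1 w := congrFun hqF ⟨w, hw⟩
    rw [hf, h, sub_self, norm_zero]

end CompactEmbedding

/-- `Z` embeds compactly into `X` via `ι`; both are separable reflexive Banach spaces. By
reflexivity the weak-star topology of `Z`, as the dual of its dual, is the weak topology, so
`Z_{w*}` is `WeakSpace ℝ Z`. -/
theorem mainTheorem7
    {Z : Type*} [NormedAddCommGroup Z] [NormedSpace ℝ Z] [CompleteSpace Z]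
    [TopologicalSpace.SeparableSpace Z] [MeasurableSpace Z] [BorelSpace Z]
    (hZ : IsReflexiveSpace Z)
    {X : Type*} [NormedAddCommGroup X] [NormedSpace ℝ X] [CompleteSpace X]
    [TopologicalSpace.SeparableSpace X] [MeasurableSpace X] [BorelSpace X]
    (hX : IsReflexiveSpace X)
    (ι : Z →L[ℝ] X) (hι_inj : Function.Injective ι) (hι : IsCompactOperator ι)
    (ψ : AdmissibleWeight (WeakSpace ℝ Z))
    {Ω : Type*} {mΩ : MeasurableSpace Ω} (μ : Measure Ω) [IsProbabilityMeasure μ]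
    (ℱ : Filtration ℝ≥0 mΩ)
    -- the Markov process on `Z`, with weakly right continuous trajectories
    (x : ℝ≥0 → Z → Ω → Z) (hx : IsMarkovProcess μ ℱ x)
    (hx_cont : ∀ z : Z, ∀ᵐ ω ∂μ, ∀ t : ℝ≥0,
      ContinuousWithinAt (fun s => toWeakSpace ℝ Z (x s z ω)) (Set.Ici t) t)
    -- the moment bound on `Z`
    (C : ℝ) (ε : ℝ≥0) (hε : 0 < ε)
    (hψ : ∀ (z : Z) (t : ℝ≥0), t ≤ ε →
      ∫⁻ ω, ENNReal.ofReal (ψ (toWeakSpace ℝ Z (x t z ω))) ∂μ ≤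
        ENNReal.ofReal (C * ψ (toWeakSpace ℝ Z z)))
    -- the extension of the Markov process to `X`
    (y : ℝ≥0 → X → Ω → X) (hy : IsMarkovProcess μ ℱ y)
    (hxy : ∀ (t : ℝ≥0) (z : Z), ∀ᵐ ω ∂μ, y t (ι z) ω = ι (x t z ω))
    (hy_cont : ∀ (t : ℝ≥0) (f : BoundedContinuousFunction X ℝ),
      Continuous fun x₀ : X => ∫ ω, f (y t x₀ ω) ∂μ) :
    ∃ P : ℝ≥0 → GrowthControlled ψ →L[ℝ] GrowthControlled ψ,
      (∀ (t : ℝ≥0) (f : GrowthControlled ψ) (z : Z),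
        Integrable (fun ω => f.1 (toWeakSpace ℝ Z (x t z ω))) μ ∧
        (P t f).1 (toWeakSpace ℝ Z z) = ∫ ω, f.1 (toWeakSpace ℝ Z (x t z ω)) ∂μ) ∧
      IsGeneralisedFellerSemigroup P ∧ IsStronglyContinuousAtZero P := by
  let φ : Z ≃ᵐ WeakSpace ℝ Z := toWeakSpaceMeasurableEquiv
  have hx' := hx.map_equiv φ
  let κ := hx'.kernel
  have hκ_add : ∀ s t, κ (s + t) = ProbabilityTheory.Kernel.comp (κ t) (κ s) := hx'.kernel_add
  have hxm : ∀ t z, Measurable fun ω => toWeakSpace ℝ Z (x t z ω) := fun t z =>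
    φ.measurable.comp (hx.measurable t z)
  have hκ : ∀ t z, κ t (toWeakSpace ℝ Z z) = μ.map fun ω => toWeakSpace ℝ Z (x t z ω) :=
    fun t z => rfl
  have hκ_int : ∀ t (f : GrowthControlled ψ) z, ∫ w, f.1 w ∂(κ t (toWeakSpace ℝ Z z)) =
      ∫ ω, f.1 (toWeakSpace ℝ Z (x t z ω)) ∂μ := fun t f z => by
    rw [hκ, integral_map (hxm t z).aemeasurable f.measurable.aestronglyMeasurable]
  have hκ_small : ∀ t ≤ ε, (κ t).WeightBound ψ C := by
    intro t ht w
    obtain ⟨z, rfl⟩ := (toWeakSpace ℝ Z).surjective w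
    rw [hκ, lintegral_map ψ.measurable.ennreal_ofReal (hxm t z)]
    exact hψ z t ht
  choose c hc hcκ using exists_weightBound_of_semigroup hκ_add hε hκ_small
  have hop : ∀ t, ∃ T : GrowthControlled ψ →L[ℝ] GrowthControlled ψ,
      ∀ f s, (T f).1 s = ∫ s', f.1 s' ∂(κ t s) := by
    refine fun t => (hcκ t).exists_operator (hc t) fun g hg ⟨M, hM⟩ η hη => ?_
    obtain ⟨q, f, hgf, hf⟩ := hι.exists_boundedContinuous_approx hι_inj hg hM hη
    -- The Feller property on `X` enters here: `k` is `E[q(y t ·)]` pulled back by `ι`, and `hxy`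
    -- identifies it with the image of `f`.
    obtain ⟨k, hk⟩ := hι.exists_growthControlled ψ (hy_cont t q) (M := ‖q‖) fun a => by
      simpa using norm_integral_le_of_norm_le_const (μ := μ)
        (Eventually.of_forall fun ω => q.norm_coe_le_norm (y t a ω))
    refine ⟨f, k, hgf, fun w => ?_⟩
    obtain ⟨z, rfl⟩ := (toWeakSpace ℝ Z).surjective w
    rw [hk, hκ_int]
    refine integral_congr_ae ?_
    filter_upwards [hxy t z] with ω hω
    rw [hf, LinearEquiv.symm_apply_apply, LinearEquiv.symm_apply_apply, hω]
  choose P hP using hop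
  have hP_zero : P 0 = ContinuousLinearMap.id ℝ (GrowthControlled ψ) := by
    refine ContinuousLinearMap.ext fun f => Subtype.ext (Subtype.ext (funext fun w => ?_))
    rw [hP, show κ 0 = ProbabilityTheory.Kernel.id from hx'.kernel_zero,
      ProbabilityTheory.Kernel.id_apply,
      integral_dirac' _ _ f.measurable.stronglyMeasurable]
    rfl
  have hP_bdd : ∃ C' : ℝ, ∃ ε' : ℝ≥0, 0 < ε' ∧ ∀ t ≤ ε', ‖P t‖ ≤ C' :=
    ⟨max C 0, ε, hε, fun t ht =>
      ((hκ_small t ht).mono (le_max_left C 0)).opNorm_le (le_max_right C 0) (P t) (hP t)⟩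
  have hP_strong : IsStronglyContinuousAtZero P := by
    -- The sublevel sets are first countable because `ι` embeds them into the metric space `X`.
    refine isStronglyContinuousAtZero_of_kernel hκ_add hP (fun R hR =>
      (hι.isClosedEmbedding_of_isCompact hι_inj
        (ψ.isCompact_sublevel' R hR)).isInducing.firstCountableTopology) hP_zero hP_bdd ?_
    rintro f hf ⟨M, hM⟩ w t
    obtain ⟨z, rfl⟩ := (toWeakSpace ℝ Z).surjective w
    simp_rw [hP, hκ_int]
    refine tendsto_integral_filter_of_dominated_convergence (fun _ => M)
      (Eventually.of_forall fun r => (f.measurable.comp (hxm r z)).aestronglyMeasurable)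
      (Eventually.of_forall fun r => Eventually.of_forall fun ω => hM _) (integrable_const M) ?_
    filter_upwards [hx_cont z] with ω hω
    exact hf.continuousAt.comp_continuousWithinAt (hω t)
  refine ⟨P, fun t f z => ⟨?_, ?_⟩, ⟨hP_zero, fun t s => ?_, fun f w => ?_, hP_bdd,
    fun t f hf w => ?_⟩, hP_strong⟩
  · have h := (hcκ t).integrable f (toWeakSpace ℝ Z z)
    rw [hκ] at h
    exact h.comp_measurable (hxm t z)
  · rw [hP, hκ_int]
  · refine ContinuousLinearMap.ext fun f => Subtype.ext (Subtype.ext (funext fun w => ?_))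
    rw [ContinuousLinearMap.comp_apply, hP, hP, hκ_add, ProbabilityTheory.Kernel.integral_comp]
    · simp_rw [hP]
    · rw [← hκ_add]
      exact (hcκ (t + s)).integrable f w
  -- Convergence in the weighted norm implies pointwise convergence.
  · rw [tendsto_iff_norm_sub_tendsto_zero]
    have hlim := (hP_strong f).mul_const (ψ w)
    rw [zero_mul] at hlim
    exact squeeze_zero (fun _ => norm_nonneg _) (fun t => (P t f - f).norm_apply_le w) hlim
  · rw [hP]
    exact integral_nonneg hf
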